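/- Let $n\ge 0$ and let $\langle z,w\rangle=z_1\overline{w_1}+\dots+z_n\overline{w_n}-z_{n+1}\overline{w_{n+1}}$ on $\mathbb C^{n+1}$. Let $\mathrm U(n,1)\subset\mathrm{GL}_{n+1}(\mathbb C)$ be the group preserving this form, $\mathrm{SU}(n,1)$ its subgroup of elements of determinant $1$, and $G=\mathrm{PU}(n,1)$ the quotient of $\mathrm U(n,1)$ by its center (the homotheties it contains). An element of $G$ is elliptic if it fixes a point of $\mathbb H^n_{\mathbb C}=\{[z]\in\mathbb{CP}^n : \langle z,z\rangle<0\}$. Put $$\mathcal T(G)=\{(\alpha_1,\dots,\alpha_n)\in[0,2\pi)^n : \alpha_1\ge\dots\ge\alpha_n\},$$ and let $\mathring{\mathcal T(G)}$ be its interior in $\mathbb R^n$. For an elliptic conjugacy class $\mathcal C$ of $G$ there is a unique $i(\mathcal C)=(\alpha_1,\dots,\alpha_n)\in\mathcal T(G)$ such that every element of $\mathcal C$ has a lift to $\mathrm U(n,1)$ that is conjugate to $\operatorname{diag}(e^{i\alpha_1},\dots,e^{i\alpha_n},1)$. The standard lift of $g\in\mathcal C$ is its unique lift $\tilde g\in\mathrm{SU}(n,1)$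 that is conjugate in $\mathrm{SU}(n,1)$ to the diagonal matrix with entries $$e^{i\left(n\alpha_j-\sum_{k\ne j}\alpha_k\right)/(n+1)}\quad(1\le j\le n),\qquad e^{-i(\alpha_1+\dots+\alpha_n)/(n+1)}.$$ Let $\Gamma=\langle a,b,c\mid abc=1\rangle$. For $u\in\mathbb C$ with $u^{n+1}=1$, let $\mathcal P(G)_u\subset\mathcal T(G)^3$ be the set of triples $(i(\mathcal C_1),i(\mathcal C_2),i(\mathcal C_3))$, where $\mathcal C_1,\mathcal C_2,\mathcal C_3$ are the conjugacy classes of $\rho(a),\rho(b),\rho(c)$ for some homomorphism $\rho:\Gamma\to G$ such that $\rho(a),\rho(b),\rho(c)$ are elliptic and $\widetilde{\rho(a)}\,\widetilde{\rho(b)}\,\widetilde{\rho(c)}=u\,\mathrm{Id}$. Then for every $n$ and every $u$ with $u^{n+1}=1$, the set $\mathcal P(G)_u\cap\mathring{\mathcal T(G)}^3$ is closed in $\mathring{\mathcal T(G)}^3$ for the subspace topology. -/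

import Mathlib

open scoped LinearAlgebra.Projectivization

noncomputable section

namespace ComplexHorn

/-- The vector space `ℂ^{n+1}`: the first `n` coordinates are `inl i`, the last one is `inr ()`. -/
abbrev Vec (n : ℕ) : Type := Fin n ⊕ Unit → ℂ

/-- The Hermitian form `⟨z, w⟩ = z₁ w̄₁ + ⋯ + zₙ w̄ₙ - zₙ₊₁ w̄ₙ₊₁` of signature `(n, 1)`. -/
def herm (n : ℕ) (z w : Vec n) : ℂ :=
  ∑ i : Fin n, z (Sum.inl i) * star (w (Sum.inl i)) - z (Sum.inr ()) * star (w (Sum.inr ()))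

/-- `U(n,1)`: the invertible matrices that preserve the Hermitian form. -/
def U (n : ℕ) : Subgroup (GL (Fin n ⊕ Unit) ℂ) where
  carrier := {A | ∀ z w : Vec n, herm n (A.1.mulVec z) (A.1.mulVec w) = herm n z w}
  one_mem' := fun z w => by simp
  mul_mem' := fun {A B} hA hB z w => by
    have h := hA (B.1.mulVec z) (B.1.mulVec w)
    rw [Matrix.mulVec_mulVec, Matrix.mulVec_mulVec] at h
    exact h.trans (hB z w)
  inv_mem' := fun {A} hA z w => by
    have h := hA ((A⁻¹).1.mulVec z) ((A⁻¹).1.mulVec w)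
    rw [Matrix.mulVec_mulVec, Matrix.mulVec_mulVec, Units.mul_inv, Matrix.one_mulVec,
      Matrix.one_mulVec] at h
    exact h.symm

/-- `SU(n,1)`, as a subgroup of `U(n,1)`. -/
def SU (n : ℕ) : Subgroup (U n) :=
  (Matrix.GeneralLinearGroup.det.comp (U n).subtype).ker

/-- `PU(n,1)`: the quotient of `U(n,1)` by its center. -/
abbrev PU (n : ℕ) : Type := U n ⧸ Subgroup.center (U n)

/-- The projection `U(n,1) → PU(n,1)`. -/
def proj (n : ℕ) : U n →* PU n := QuotientGroup.mk' (Subgroup.center (U n))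

/-- Complex hyperbolic space: the lines of `ℂ^{n+1}` spanned by negative vectors. -/
def hyperbolicSpace (n : ℕ) : Set (ℙ ℂ (Vec n)) :=
  {p | ∃ (v : Vec n) (hv : v ≠ 0), (herm n v v).re < 0 ∧ Projectivization.mk ℂ v hv = p}

/-- An element of `PU(n,1)` is elliptic if it fixes a point of complex hyperbolic space. It acts on
projective space through any of its lifts to `U(n,1)`; two lifts differ by a homothety, so they act
in the same way. -/
def IsElliptic (n : ℕ) (g : PU n) : Prop :=
  ∃ p ∈ hyperbolicSpace n, ∃ A : U n, proj n A = g ∧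
    Matrix.GeneralLinearGroup.toLin (A : GL (Fin n ⊕ Unit) ℂ) • p = p

/-- The space `T(G)` of angles, for `G = PU(n,1)`: the tuples in `[0, 2π)^n` with
`α₁ ≥ ⋯ ≥ αₙ`. -/
def angleSpace (n : ℕ) : Set (Fin n → ℝ) :=
  {α | (∀ i, 0 ≤ α i ∧ α i < 2 * Real.pi) ∧ Antitone α}

/-- The diagonal matrix with diagonal entries `e^{iθ₁}, …, e^{iθₙ}, e^{iφ}`. -/
def diagMatrix (n : ℕ) (θ : Fin n → ℝ) (φ : ℝ) : Matrix (Fin n ⊕ Unit) (Fin n ⊕ Unit) ℂ :=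
  Matrix.diagonal fun k => Complex.exp (Sum.elim θ (fun _ => φ) k * Complex.I)

lemma diagMatrix_mul_neg (n : ℕ) (θ : Fin n → ℝ) (φ : ℝ) :
    diagMatrix n θ φ * diagMatrix n (-θ) (-φ) = 1 := by
  rw [diagMatrix, diagMatrix, Matrix.diagonal_mul_diagonal, ← Matrix.diagonal_one]
  congr 1
  funext k
  rw [← Complex.exp_add]
  cases k <;> simp

lemma exp_mul_star (x : ℝ) (a b : ℂ) :
    Complex.exp (x * Complex.I) * a * star (Complex.exp (x * Complex.I) * b) = a * star b := by
  have h : Complex.exp (x * Complex.I) * star (Complex.exp (x * Complex.I)) = 1 := by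
    rw [Complex.star_def, Complex.mul_conj, Complex.normSq_eq_norm_sq,
      Complex.norm_exp_ofReal_mul_I]
    simp
  rw [star_mul']
  linear_combination (a * star b) * h

/-- `diagMatrix` as an element of `U(n,1)`. -/
def diagU (n : ℕ) (θ : Fin n → ℝ) (φ : ℝ) : U n :=
  ⟨⟨diagMatrix n θ φ, diagMatrix n (-θ) (-φ), diagMatrix_mul_neg n θ φ, by
      simpa using diagMatrix_mul_neg n (-θ) (-φ)⟩, fun z w => by
    simp only [herm, diagMatrix, Matrix.mulVec_diagonal, exp_mul_star]⟩

/-- The matrix `E(α₁, …, αₙ) = diag(e^{iα₁}, …, e^{iαₙ}, 1)`, as an element of `U(n,1)`. -/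
def E (n : ℕ) (α : Fin n → ℝ) : U n := diagU n α 0

/-- `HasAngles n c α` says that `α` is the tuple of angles of the conjugacy class `c`: it lies in
`T(G)`, and every element of `c` has a lift to `U(n,1)` that is conjugate to `E(α₁, …, αₙ)`.
An elliptic class has exactly one such `α`. -/
def HasAngles (n : ℕ) (c : ConjClasses (PU n)) (α : Fin n → ℝ) : Prop :=
  α ∈ angleSpace n ∧
    ∀ g : PU n, ConjClasses.mk g = c → ∃ A : U n, proj n A = g ∧ IsConj A (E n α)

/-- The diagonal matrix with entries `e^{i(nαⱼ - ∑_{k≠j} αₖ)/(n+1)}` for `1 ≤ j ≤ n` and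
`e^{-i(α₁+⋯+αₙ)/(n+1)}`, as an element of `U(n,1)`. -/
def standardU (n : ℕ) (α : Fin n → ℝ) : U n :=
  diagU n (fun j => (n * α j - ∑ k ∈ Finset.univ.erase j, α k) / (n + 1))
    (-(∑ k, α k) / (n + 1))

lemma standardU_mem (n : ℕ) (α : Fin n → ℝ) : standardU n α ∈ SU n := by
  rw [SU, MonoidHom.mem_ker]
  ext
  change (diagMatrix n _ _).det = 1
  rw [diagMatrix, Matrix.det_diagonal, ← Complex.exp_sum, ← Finset.sum_mul, Fintype.sum_sum_type]
  have hn : ((n : ℝ) + 1) ≠ 0 := by positivity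
  have h : ∑ j : Fin n, (n * α j - ∑ k ∈ Finset.univ.erase j, α k) / ((n : ℝ) + 1)
      + -(∑ k, α k) / ((n : ℝ) + 1) = 0 := by
    have e : ∀ j : Fin n, ∑ k ∈ Finset.univ.erase j, α k = ∑ k, α k - α j := fun j =>
      Finset.sum_erase_eq_sub (Finset.mem_univ j)
    simp only [e]
    rw [← Finset.sum_div, ← add_div, Finset.sum_sub_distrib, Finset.sum_sub_distrib,
      ← Finset.mul_sum]
    simp
  have h' := congrArg (fun x : ℝ => (x : ℂ)) h
  push_cast at h'
  simp only [Sum.elim_inl, Sum.elim_inr, Finset.univ_unique, Finset.sum_singleton]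
  push_cast
  rw [h']
  simp

/-- The standard lift to `SU(n,1)` of the conjugacy class with angles `α`, which is a conjugacy
class of `SU(n,1)`. -/
def standardClass (n : ℕ) (α : Fin n → ℝ) : ConjClasses (SU n) :=
  ConjClasses.mk ⟨standardU n α, standardU_mem n α⟩

/-- `A` is the standard lift to `SU(n,1)` of `g`. -/
def IsStandardLift (n : ℕ) (g : PU n) (A : SU n) : Prop :=
  proj n A = g ∧ ∃ α, HasAngles n (ConjClasses.mk g) α ∧ ConjClasses.mk A = standardClass n α

/-- The group `Γ = ⟨a, b, c | abc = 1⟩`. -/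
abbrev Gam : Type :=
  PresentedGroup ({FreeGroup.of 0 * FreeGroup.of 1 * FreeGroup.of 2} : Set (FreeGroup (Fin 3)))

/-- The three generators `a`, `b`, `c` of `Γ`. -/
def gen (j : Fin 3) : Gam := PresentedGroup.of j

/-- `Hom_ell(Γ, PU(n,1))`: the representations that send `a`, `b` and `c` to elliptic elements. -/
def HomEll (n : ℕ) : Set (Gam →* PU n) :=
  {ρ | ∀ j, IsElliptic n (ρ (gen j))}

/-- `Hom_ell(Γ, PU(n,1))_u`: the product of the standard lifts of `ρ(a)`, `ρ(b)`, `ρ(c)` is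
`u Id`. -/
def HomEllAt (n : ℕ) (u : ℂ) : Set (Gam →* PU n) :=
  {ρ | ρ ∈ HomEll n ∧ ∃ A : Fin 3 → SU n, (∀ j, IsStandardLift n (ρ (gen j)) (A j)) ∧
    ((A 0 * A 1 * A 2 : SU n) : GL (Fin n ⊕ Unit) ℂ).1 =
      u • (1 : Matrix (Fin n ⊕ Unit) (Fin n ⊕ Unit) ℂ)}

/-- `P(PU(n,1))_u`: the triples of angle tuples of the classes of `ρ(a)`, `ρ(b)`, `ρ(c)`, for `ρ`
in `Hom_ell(Γ, PU(n,1))_u`. -/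
def solutionSet (n : ℕ) (u : ℂ) : Set (Fin 3 → Fin n → ℝ) :=
  {τ | ∃ ρ ∈ HomEllAt n u, ∀ j, HasAngles n (ConjClasses.mk (ρ (gen j))) (τ j)}

/-- The product of three copies of the interior of `T(PU(n,1))`. -/
def interiorTriples (n : ℕ) : Set (Fin 3 → Fin n → ℝ) :=
  {τ | ∀ j, τ j ∈ interior (angleSpace n)}

end ComplexHorn

end

/-!
Three elliptic elements whose standard lifts multiply to `u` are, up to a simultaneous conjugation,
solutions of `S₀ (h S₁ h⁻¹) (g S₂ g⁻¹) = u` with `h`, `g` in `SU(n,1)`, where the `Sⱼ` are the standard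
diagonal matrices (`mem_solutionSet_iff`; this uses that an elliptic class has only one tuple of
angles, `HasAngles.unique`). This equation is closed in the angles and in `h`, `g`, so the claim
follows once `h` and `g` stay bounded when the angles stay in a compact part of the open chamber:
the set of angles that admit a solution bounded by `R` is the projection of a closed set along a
compact factor (`isClosed_boundedSolutionSet`).

Boundedness is a fact of hyperbolic geometry. In the open chamber no angle vanishes, so every
eigenvalue ratio `e^{iαⱼ}` stays at a distance at least `ε > 0` from `1`. An elliptic element `B` with
this property and with fixed point `q` turns every geodesic ray from `q` by an angle bounded from
below, so `q` is at bounded distance from the midpoint of `r` and `B r`, for every point `r`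
(`midpoint_estimate`). Let `A B C` be scalar, with fixed points `p`, `q`, `r`, and put `s = B r`. Since
`C` fixes `r`, the element `A` maps `s` back to `r` in hyperbolic space, so `p` and `q` are both
close to the midpoint of `r` and `s`, and thus close to each other (`norm_herm_fixedPoints_le`).
As `|⟨p, q⟩|` is the hyperbolic cosine of the distance and the entries of `h` are bounded in terms of
`|⟨h e, e⟩|` (`norm_entry_le`), this bounds `h`, and `g` by cyclic symmetry.
-/

noncomputable section

namespace ComplexHorn

open Matrix Complex

variable {n : ℕ}

/-! ### The Hermitian form -/

/-- The last basis vector, which spans the line fixed by the diagonal elements of `U(n,1)`. -/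
def basePt (n : ℕ) : Vec n := Pi.single (Sum.inr ()) 1

/-- The squared Euclidean norm of the first `n` coordinates. -/
def posSq (z : Vec n) : ℝ := ∑ i, ‖z (Sum.inl i)‖ ^ 2

lemma posSq_nonneg (z : Vec n) : 0 ≤ posSq z := Finset.sum_nonneg fun _ _ => by positivity

lemma mul_star_self (c : ℂ) : c * star c = ((‖c‖ ^ 2 : ℝ) : ℂ) := by
  rw [star_def, mul_conj, normSq_eq_norm_sq]

lemma herm_self (z : Vec n) : herm n z z = ((posSq z - ‖z (Sum.inr ())‖ ^ 2 : ℝ) : ℂ) := by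
  simp only [herm, posSq, mul_star_self]
  push_cast
  rfl

lemma herm_add_left (x y z : Vec n) : herm n (x + y) z = herm n x z + herm n y z := by
  simp only [herm, Pi.add_apply, add_mul, Finset.sum_add_distrib]
  ring

lemma herm_add_right (x y z : Vec n) : herm n x (y + z) = herm n x y + herm n x z := by
  simp only [herm, Pi.add_apply, star_add, mul_add, Finset.sum_add_distrib]
  ring

lemma herm_smul_left (c : ℂ) (x y : Vec n) : herm n (c • x) y = c * herm n x y := by
  simp only [herm, Pi.smul_apply, smul_eq_mul, mul_sub, Finset.mul_sum, mul_assoc]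

lemma herm_swap (x y : Vec n) : herm n x y = star (herm n y x) := by
  simp [herm, mul_comm]

lemma herm_smul_right (c : ℂ) (x y : Vec n) : herm n x (c • y) = star c * herm n x y := by
  rw [herm_swap, herm_smul_left, star_mul', ← herm_swap]

lemma norm_herm_comm (x y : Vec n) : ‖herm n x y‖ = ‖herm n y x‖ := by
  rw [herm_swap, norm_star]

lemma herm_basePt_right (x : Vec n) : herm n x (basePt n) = -x (Sum.inr ()) := by
  simp [herm, basePt]

lemma norm_herm_basePt (x : Vec n) : ‖herm n x (basePt n)‖ = ‖x (Sum.inr ())‖ := by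
  rw [herm_basePt_right, norm_neg]

lemma herm_basePt_self : herm n (basePt n) (basePt n) = -1 := by
  rw [herm_basePt_right]; simp [basePt]

lemma norm_pos_pairing_le (x y : Vec n) :
    ‖∑ i, x (Sum.inl i) * star (y (Sum.inl i))‖ ≤ √(posSq x) * √(posSq y) := by
  refine (norm_sum_le _ _).trans ?_
  simp only [norm_mul, norm_star]
  exact Real.sum_mul_le_sqrt_mul_sqrt _ _ _

lemma norm_herm_le (x y : Vec n) :
    ‖herm n x y‖ ≤ √(posSq x) * √(posSq y) + ‖x (Sum.inr ())‖ * ‖y (Sum.inr ())‖ := by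
  refine (norm_sub_le _ _).trans ?_
  rw [norm_mul, norm_star]
  gcongr
  exact norm_pos_pairing_le x y

lemma le_norm_herm (x y : Vec n) :
    ‖x (Sum.inr ())‖ * ‖y (Sum.inr ())‖ - √(posSq x) * √(posSq y) ≤ ‖herm n x y‖ := by
  have h1 := norm_pos_pairing_le x y
  have h2 := norm_sub_norm_le (x (Sum.inr ()) * star (y (Sum.inr ())))
    (∑ i, x (Sum.inl i) * star (y (Sum.inl i)))
  rw [norm_sub_rev, norm_mul, norm_star] at h2
  rw [herm]
  linarith

/-- A quantitative reverse Cauchy-Schwarz inequality for `x` at bounded distance from the base point,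
which is the meaning of `hx`, and `z` not positive. It uses `√(1 - δ) ≤ 1 - δ / 2`. -/
lemma mul_le_norm_herm {δ : ℝ} (hδ : δ ≤ 1) (x z : Vec n)
    (hx : posSq x ≤ (1 - δ) * ‖x (Sum.inr ())‖ ^ 2) (hz : posSq z ≤ ‖z (Sum.inr ())‖ ^ 2) :
    δ * ‖x (Sum.inr ())‖ * ‖z (Sum.inr ())‖ ≤ 2 * ‖herm n x z‖ := by
  have h := le_norm_herm x z
  have hx' : √(posSq x) ≤ (1 - δ / 2) * ‖x (Sum.inr ())‖ := by
    apply Real.sqrt_le_iff.mpr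
    refine ⟨mul_nonneg (by linarith) (norm_nonneg _), hx.trans ?_⟩
    rw [mul_pow]
    gcongr
    nlinarith [sq_nonneg δ]
  have hz' : √(posSq z) ≤ ‖z (Sum.inr ())‖ := by
    rw [← Real.sqrt_sq (norm_nonneg (z (Sum.inr ())))]
    exact Real.sqrt_le_sqrt hz
  have h3 : √(posSq x) * √(posSq z) ≤ (1 - δ / 2) * ‖x (Sum.inr ())‖ * ‖z (Sum.inr ())‖ :=
    mul_le_mul hx' hz' (Real.sqrt_nonneg _) (mul_nonneg (by linarith) (norm_nonneg _))
  nlinarith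

/-! ### Action of the unitary group -/

lemma herm_mulVec (g : U n) (x y : Vec n) :
    herm n (g.1.1 *ᵥ x) (g.1.1 *ᵥ y) = herm n x y := g.2 x y

lemma mul_mulVec (g h : U n) (x : Vec n) : (g * h).1.1 *ᵥ x = g.1.1 *ᵥ (h.1.1 *ᵥ x) := by
  rw [Matrix.mulVec_mulVec]; rfl

lemma inv_mulVec_mulVec (g : U n) (x : Vec n) : (g⁻¹).1.1 *ᵥ (g.1.1 *ᵥ x) = x := by
  rw [← mul_mulVec, inv_mul_cancel]; exact Matrix.one_mulVec x

lemma mulVec_inv_mulVec (g : U n) (x : Vec n) : g.1.1 *ᵥ ((g⁻¹).1.1 *ᵥ x) = x := by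
  rw [← mul_mulVec, mul_inv_cancel]; exact Matrix.one_mulVec x

lemma herm_mulVec_left (g : U n) (x y : Vec n) :
    herm n (g.1.1 *ᵥ x) y = herm n x ((g⁻¹).1.1 *ᵥ y) := by
  rw [← herm_mulVec g x, mulVec_inv_mulVec]

lemma diagU_mulVec_inl (θ : Fin n → ℝ) (φ : ℝ) (x : Vec n) (i : Fin n) :
    ((diagU n θ φ).1.1 *ᵥ x) (Sum.inl i) = exp (θ i * I) * x (Sum.inl i) :=
  Matrix.mulVec_diagonal _ _ _

lemma diagU_mulVec_inr (θ : Fin n → ℝ) (φ : ℝ) (x : Vec n) :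
    ((diagU n θ φ).1.1 *ᵥ x) (Sum.inr ()) = exp (φ * I) * x (Sum.inr ()) :=
  Matrix.mulVec_diagonal _ _ _

lemma E_mulVec_inr (θ : Fin n → ℝ) (x : Vec n) :
    ((E n θ).1.1 *ᵥ x) (Sum.inr ()) = x (Sum.inr ()) := by
  rw [E, diagU_mulVec_inr]; simp

lemma E_mulVec_basePt (θ : Fin n → ℝ) : (E n θ).1.1 *ᵥ basePt n = basePt n := by
  funext k
  rcases k with i | ⟨⟩
  · rw [E, diagU_mulVec_inl]; simp [basePt]
  · exact E_mulVec_inr θ _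

lemma posSq_E_mulVec (θ : Fin n → ℝ) (x : Vec n) : posSq ((E n θ).1.1 *ᵥ x) = posSq x := by
  simp only [posSq, E, diagU_mulVec_inl, norm_mul, norm_exp_ofReal_mul_I, one_mul]

/-- If every `e^{iθⱼ}` is at distance at least `ε` from `1`, then `|1 + e^{iθⱼ}|² ≤ 4 - ε²`, while the
last coordinate of `x` is doubled: passing to the midpoint moves towards the base point. -/
lemma posSq_add_E_mulVec_le {ε : ℝ} (h0 : 0 ≤ ε) {θ : Fin n → ℝ}
    (hθ : ∀ i, ε ≤ ‖exp (θ i * I) - 1‖) (x : Vec n) :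
    posSq (x + (E n θ).1.1 *ᵥ x) ≤ (4 - ε ^ 2) * posSq x := by
  simp only [posSq, Pi.add_apply, E, diagU_mulVec_inl]
  rw [Finset.mul_sum]
  refine Finset.sum_le_sum fun i _ => ?_
  rw [← one_add_mul, norm_mul, mul_pow]
  gcongr
  have hp := parallelogram_law_with_norm ℝ (1 : ℂ) (exp (θ i * I))
  rw [norm_exp_ofReal_mul_I, norm_one, norm_sub_rev] at hp
  have := pow_le_pow_left₀ h0 (hθ i) 2
  nlinarith

lemma posSq_eq {x : Vec n} (hx : herm n x x = -1) : posSq x = ‖x (Sum.inr ())‖ ^ 2 - 1 := by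
  rw [herm_self] at hx
  have hx' : posSq x - ‖x (Sum.inr ())‖ ^ 2 = -1 := by exact_mod_cast hx
  linarith

lemma norm_herm_E_mulVec_le (θ : Fin n → ℝ) {x : Vec n} (hx : herm n x x = -1) :
    ‖herm n x ((E n θ).1.1 *ᵥ x)‖ ≤ 2 * ‖x (Sum.inr ())‖ ^ 2 - 1 := by
  have h := norm_herm_le x ((E n θ).1.1 *ᵥ x)
  rw [posSq_E_mulVec, E_mulVec_inr, Real.mul_self_sqrt (posSq_nonneg x), posSq_eq hx] at h
  linarith

lemma posSq_le_iff (z : Vec n) : posSq z ≤ ‖z (Sum.inr ())‖ ^ 2 ↔ (herm n z z).re ≤ 0 := by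
  rw [herm_self, ofReal_re, sub_nonpos]

/-- Let `y` be the image of the unit negative vector `x` under the elliptic element with fixed point
`g e` and angles `θ`, where every `e^{iθⱼ}` is at distance at least `ε` from `1`. The midpoint `x + y`
is at bounded distance from the fixed point, so for every non-positive `z` the pairing of `z` with
the midpoint controls the pairing of `z` with the fixed point. -/
lemma midpoint_estimate {ε : ℝ} (hε : ε ^ 2 ≤ 4) (h0 : 0 < ε) {θ : Fin n → ℝ}
    (hθ : ∀ i, ε ≤ ‖exp (θ i * I) - 1‖) (g : U n) {x y : Vec n} (hx : herm n x x = -1)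
    (hy : (g * E n θ * g⁻¹).1.1 *ᵥ x = y) :
    (herm n (x + y) (x + y)).re ≤ 0 ∧
    0 < ‖herm n x (g.1.1 *ᵥ basePt n)‖ ∧
    ‖herm n x y‖ ≤ 2 * ‖herm n x (g.1.1 *ᵥ basePt n)‖ ^ 2 - 1 ∧
    ∀ z, (herm n z z).re ≤ 0 →
      ε ^ 2 * ‖herm n x (g.1.1 *ᵥ basePt n)‖ * ‖herm n z (g.1.1 *ᵥ basePt n)‖
        ≤ 4 * ‖herm n (x + y) z‖ := by
  obtain ⟨x, rfl⟩ : ∃ x', g.1.1 *ᵥ x' = x := ⟨_, mulVec_inv_mulVec g x⟩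
  rw [mul_mulVec, inv_mulVec_mulVec, mul_mulVec] at hy
  subst hy
  rw [herm_mulVec] at hx
  have hP := posSq_eq hx
  have hm := posSq_add_E_mulVec_le h0.le hθ x
  have hX : (x + (E n θ).1.1 *ᵥ x) (Sum.inr ()) = 2 * x (Sum.inr ()) := by
    rw [Pi.add_apply, E_mulVec_inr]; ring
  have hX' : ‖(x + (E n θ).1.1 *ᵥ x) (Sum.inr ())‖ = 2 * ‖x (Sum.inr ())‖ := by
    rw [hX, norm_mul]; simp
  rw [← mulVec_add]
  simp only [herm_mulVec, norm_herm_basePt]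
  have hm' : posSq (x + (E n θ).1.1 *ᵥ x) ≤
      (1 - ε ^ 2 / 4) * ‖(x + (E n θ).1.1 *ᵥ x) (Sum.inr ())‖ ^ 2 := by
    rw [hX']; nlinarith
  refine ⟨?_, ?_, norm_herm_E_mulVec_le θ hx, fun z hz => ?_⟩
  · rw [← posSq_le_iff]
    refine hm'.trans ?_
    nlinarith [sq_nonneg ‖(x + (E n θ).1.1 *ᵥ x) (Sum.inr ())‖, sq_nonneg ε]
  · refine lt_of_le_of_ne (norm_nonneg _) fun h => ?_
    have := posSq_nonneg x
    rw [hP, ← h] at this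
    norm_num at this
  · obtain ⟨z, rfl⟩ : ∃ z', g.1.1 *ᵥ z' = z := ⟨_, mulVec_inv_mulVec g z⟩
    simp only [herm_mulVec, norm_herm_basePt] at hz ⊢
    have := mul_le_norm_herm (δ := ε ^ 2 / 4) (by linarith) _ z hm' ((posSq_le_iff z).2 hz)
    rw [hX'] at this
    linarith

/-- If the product of three elliptic elements is scalar, and every `e^{iθⱼ}` for the angles of the
first two is at distance at least `ε` from `1`, then the fixed points of these two are at bounded
distance: with `r` the fixed point of the third element and `s` its image under the second one, both
fixed points are close to the midpoint of `r` and `s`. -/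
lemma norm_herm_fixedPoints_le {ε : ℝ} (hε : ε ^ 2 ≤ 4) (h0 : 0 < ε) {θ₀ θ₁ θ₂ : Fin n → ℝ}
    (hθ₀ : ∀ i, ε ≤ ‖exp (θ₀ i * I) - 1‖) (hθ₁ : ∀ i, ε ≤ ‖exp (θ₁ i * I) - 1‖)
    (a b c : U n) {κ : ℂ} (hκ : ‖κ‖ = 1)
    (h : (a * E n θ₀ * a⁻¹ * (b * E n θ₁ * b⁻¹) * (c * E n θ₂ * c⁻¹)).1.1 = κ • 1) :
    ‖herm n (a.1.1 *ᵥ basePt n) (b.1.1 *ᵥ basePt n)‖ ≤ 64 / ε ^ 4 := by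
  set p := a.1.1 *ᵥ basePt n with hp
  set q := b.1.1 *ᵥ basePt n with hq
  set r := c.1.1 *ᵥ basePt n with hr
  set s := (b * E n θ₁ * b⁻¹).1.1 *ᵥ r with hs
  have hcr : (c * E n θ₂ * c⁻¹).1.1 *ᵥ r = r := by
    rw [mul_mulVec, hr, inv_mulVec_mulVec, mul_mulVec, E_mulVec_basePt]
  have has : (a * E n θ₀ * a⁻¹).1.1 *ᵥ s = κ • r := by
    rw [hs, ← mul_mulVec]
    nth_rewrite 1 [← hcr]
    rw [← mul_mulVec, h, smul_mulVec, one_mulVec]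
  have hrr : herm n r r = -1 := by rw [hr, herm_mulVec, herm_basePt_self]
  have hss : herm n s s = -1 := by rw [hs, herm_mulVec, hrr]
  have hpp : (herm n p p).re ≤ 0 := by rw [hp, herm_mulVec, herm_basePt_self]; simp
  obtain ⟨hm, hb, hrs, H₁⟩ := midpoint_estimate hε h0 hθ₁ b hrr hs.symm
  obtain ⟨-, ha, hsr, H₀⟩ := midpoint_estimate hε h0 hθ₀ a hss has
  have e₀ := H₀ _ hm
  have e₁ := H₁ _ hpp
  rw [← hp] at e₀ hsr ha
  rw [← hq] at e₁ hrs hb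
  rw [herm_smul_right, norm_mul, norm_star, hκ, one_mul] at hsr
  -- `s + κ r` and `r + s` both represent a midpoint of `r` and `s`, as seen from `p` and from `q`;
  -- the bounds `hsr` and `hrs` show that they are close to each other.
  have hmm : ‖herm n (s + κ • r) (r + s)‖ ≤ 2 + 2 * ‖herm n r s‖ := by
    simp only [herm_add_left, herm_add_right, herm_smul_left, hss, hrr]
    have h1 : ‖herm n s r‖ = ‖herm n r s‖ := norm_herm_comm _ _
    have := norm_add₄_le (a := herm n s r) (b := -1) (c := κ * -1) (d := κ * herm n r s)
    simp only [norm_mul, hκ, norm_neg, norm_one, h1] at this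
    calc _ = ‖herm n s r + -1 + κ * -1 + κ * herm n r s‖ := by congr 1; ring
      _ ≤ _ := this
      _ = _ := by ring
  rw [norm_herm_comm s r] at hsr
  generalize ‖herm n s p‖ = A at *
  generalize ‖herm n r q‖ = B at *
  rw [norm_herm_comm (r + s) p] at e₀ e₁
  generalize ‖herm n p (r + s)‖ = M at *
  have hAB : ‖herm n (s + κ • r) (r + s)‖ ≤ 4 * (A * B) := by
    have h1 : ‖herm n (s + κ • r) (r + s)‖ ≤ 4 * A ^ 2 := by linarith
    have h2 : ‖herm n (s + κ • r) (r + s)‖ ≤ 4 * B ^ 2 := by linarith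
    rcases le_total A B with h' | h' <;> nlinarith
  -- `M` is the pairing of `p` with the second midpoint, bounded through the first one.
  have e₂ : ε ^ 2 * M ≤ 16 * B := by
    refine le_of_mul_le_mul_left ?_ ha
    linarith
  rw [le_div_iff₀ (by positivity)]
  have e₃ : ε ^ 2 * (ε ^ 2 * B * ‖herm n p q‖) ≤ ε ^ 2 * (4 * M) :=
    mul_le_mul_of_nonneg_left e₁ (by positivity)
  refine le_of_mul_le_mul_left ?_ hb
  nlinarith

/-! ### Boundedness of matrix entries -/

lemma norm_apply_le_of_posSq_le {x : Vec n} {R : ℝ} (hR : 0 ≤ R)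
    (hx : posSq x ≤ R ^ 2) (i : Fin n) : ‖x (Sum.inl i)‖ ≤ R := by
  refine le_of_sq_le_sq ?_ hR
  exact (Finset.single_le_sum (f := fun i => ‖x (Sum.inl i)‖ ^ 2) (fun _ _ => by positivity)
    (Finset.mem_univ i)).trans hx

/-- The entries of an element of `U(n,1)` are bounded in terms of its last diagonal entry. -/
lemma norm_entry_le (g : U n) {R : ℝ} (hR : 0 ≤ R)
    (h : ‖herm n (g.1.1 *ᵥ basePt n) (basePt n)‖ ≤ R) (k l : Fin n ⊕ Unit) :
    ‖g.1.1 k l‖ ≤ R + 1 := by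
  have col : ∀ g : U n, ‖herm n (g.1.1 *ᵥ basePt n) (basePt n)‖ ≤ R → ∀ k,
      ‖(g.1.1 *ᵥ basePt n) k‖ ≤ R := by
    intro g h k
    rw [norm_herm_basePt] at h
    rcases k with i | ⟨⟩
    · refine norm_apply_le_of_posSq_le hR ?_ i
      rw [posSq_eq (by rw [herm_mulVec, herm_basePt_self])]
      have := pow_le_pow_left₀ (norm_nonneg _) h 2
      linarith
    · exact h
  rcases l with j | ⟨⟩
  · set f : Vec n := Pi.single (Sum.inl j) 1 with hf
    have hg : ∀ k, g.1.1 k (Sum.inl j) = (g.1.1 *ᵥ f) k := fun k => by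
      rw [hf, Matrix.mulVec_single_one]; rfl
    -- The last row of `g` is, up to signs and conjugation, the last column of its inverse.
    have hrow : ‖(g.1.1 *ᵥ f) (Sum.inr ())‖ ≤ R := by
      rw [← norm_herm_basePt, herm_mulVec_left]
      have h1 := col g⁻¹ (by rwa [herm_mulVec_left, inv_inv, norm_herm_comm]) (Sum.inl j)
      refine le_of_eq_of_le ?_ h1
      simp [herm, hf, Pi.single_apply]
    rw [hg]
    rcases k with i | ⟨⟩
    · refine norm_apply_le_of_posSq_le (by linarith) ?_ i
      have h1 : herm n f f = 1 := by
        simp [herm, hf, Pi.single_apply]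
      have h2 := herm_mulVec g f f
      rw [h1, herm_self] at h2
      have h3 : posSq (g.1.1 *ᵥ f) - ‖(g.1.1 *ᵥ f) (Sum.inr ())‖ ^ 2 = 1 := by exact_mod_cast h2
      have := pow_le_pow_left₀ (norm_nonneg _) hrow 2
      nlinarith
    · linarith
  · have hg : g.1.1 k (Sum.inr ()) = (g.1.1 *ᵥ basePt n) k := by
      rw [basePt, Matrix.mulVec_single_one]; rfl
    rw [hg]
    linarith [col g h k]

/-! ### The center of the unitary group -/

lemma U_ext {g h : U n} (H : ∀ x, g.1.1 *ᵥ x = h.1.1 *ᵥ x) : g = h :=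
  Subtype.ext (Units.ext (Matrix.ext_of_mulVec_single fun _ => H _))

lemma mem_center_of_eq_smul_one {g : U n} {c : ℂ} (h : g.1.1 = c • 1) :
    g ∈ Subgroup.center (U n) := by
  rw [Subgroup.mem_center_iff]
  intro k
  refine U_ext fun x => ?_
  rw [mul_mulVec, mul_mulVec, h, smul_mulVec, smul_mulVec, one_mulVec, one_mulVec, mulVec_smul]

/-- The linear map of the unitary reflection that negates `v` and fixes its orthogonal
complement, for a vector `v` that is not isotropic. -/
def reflectionLin (v : Vec n) : Vec n →ₗ[ℂ] Vec n where
  toFun x := x - (2 * herm n x v / herm n v v) • v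
  map_add' x y := by
    rw [herm_add_left]; module
  map_smul' c x := by
    rw [herm_smul_left, RingHom.id_apply]; module

lemma reflectionLin_apply (v x : Vec n) :
    reflectionLin v x = x - (2 * herm n x v / herm n v v) • v := rfl

lemma reflectionLin_reflectionLin {v : Vec n} (hv : herm n v v ≠ 0) (x : Vec n) :
    reflectionLin v (reflectionLin v x) = x := by
  have h : herm n (x - (2 * herm n x v / herm n v v) • v) v = - herm n x v := by
    rw [sub_eq_add_neg, ← neg_smul, herm_add_left, herm_smul_left]
    field_simp
    ring
  rw [reflectionLin_apply, reflectionLin_apply, h]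
  module

lemma herm_reflectionLin {v : Vec n} (hv : herm n v v ≠ 0) (x y : Vec n) :
    herm n (reflectionLin v x) (reflectionLin v y) = herm n x y := by
  have hs : star (herm n v v) = herm n v v := (herm_swap v v).symm
  simp only [reflectionLin_apply, sub_eq_add_neg, ← neg_smul, herm_add_left, herm_add_right,
    herm_smul_left, herm_smul_right]
  rw [star_neg, star_div₀, star_mul', hs, herm_swap v y, star_ofNat]
  field_simp
  ring

/-- The reflection in a vector that is not isotropic, as an element of `U(n,1)`. -/
def reflection {v : Vec n} (hv : herm n v v ≠ 0) : U n :=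
  ⟨⟨LinearMap.toMatrix' (reflectionLin v), LinearMap.toMatrix' (reflectionLin v), by
      rw [← LinearMap.toMatrix'_comp, ← LinearMap.toMatrix'_id]
      exact congrArg _ (LinearMap.ext (reflectionLin_reflectionLin hv)), by
      rw [← LinearMap.toMatrix'_comp, ← LinearMap.toMatrix'_id]
      exact congrArg _ (LinearMap.ext (reflectionLin_reflectionLin hv))⟩, fun z w => by
    simp only [LinearMap.toMatrix'_mulVec]
    exact herm_reflectionLin hv z w⟩

lemma reflection_mulVec {v : Vec n} (hv : herm n v v ≠ 0) (x : Vec n) :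
    (reflection hv).1.1 *ᵥ x = x - (2 * herm n x v / herm n v v) • v :=
  LinearMap.toMatrix'_mulVec _ _

/-- A central element commutes with the reflection in `v`, so it preserves the line of `v`. -/
lemma mulVec_eq_smul_of_mem_center {Z : U n} (hZ : Z ∈ Subgroup.center (U n)) {v : Vec n}
    (hv : herm n v v ≠ 0) : ∃ c : ℂ, Z.1.1 *ᵥ v = c • v := by
  have h := congrArg (fun g : U n => g.1.1 *ᵥ v) (Subgroup.mem_center_iff.1 hZ (reflection hv))
  simp only [mul_mulVec, reflection_mulVec, mul_div_assoc, div_self hv] at h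
  refine ⟨herm n (Z.1.1 *ᵥ v) v / herm n v v, ?_⟩
  have h2 : v - ((2 : ℂ) * 1) • v = (-1 : ℂ) • v := by module
  rw [h2, mulVec_smul] at h
  have h3 : (2 : ℂ) • (Z.1.1 *ᵥ v) = (2 : ℂ) • ((herm n (Z.1.1 *ᵥ v) v / herm n v v) • v) := by
    rw [smul_smul, ← sub_eq_zero, ← sub_eq_zero.2 h]
    module
  exact smul_right_injective _ (two_ne_zero' ℂ) h3

/-- The center of `U(n,1)` consists of homotheties. -/
lemma eq_smul_of_mem_center {Z : U n} (hZ : Z ∈ Subgroup.center (U n)) :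
    ∃ c : ℂ, ∀ x, Z.1.1 *ᵥ x = c • x := by
  have hb : herm n (basePt n) (basePt n) ≠ 0 := by rw [herm_basePt_self]; norm_num
  obtain ⟨c, hc⟩ := mulVec_eq_smul_of_mem_center hZ hb
  refine ⟨c, fun x => ?_⟩
  suffices h : Z.1.1.mulVecLin = c • LinearMap.id from congrArg (· x) h
  refine LinearMap.pi_ext' fun k => LinearMap.ext_ring ?_
  change Z.1.1 *ᵥ Pi.single k 1 = c • Pi.single k 1
  rcases k with i | ⟨⟩
  · -- The eigenvalues on a positive basis vector, on the base point and on `v = 2 eᵢ + e` agree.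
    set f : Vec n := Pi.single (Sum.inl i) 1 with hf
    have hff : herm n f f = 1 := by simp [herm, hf, Pi.single_apply]
    have hfb : herm n f (basePt n) = 0 := by rw [herm_basePt_right]; simp [hf]
    have hbf : herm n (basePt n) f = 0 := by rw [herm_swap, hfb, star_zero]
    obtain ⟨a, ha⟩ := mulVec_eq_smul_of_mem_center hZ (v := f) (by rw [hff]; exact one_ne_zero)
    obtain ⟨b, hb'⟩ := mulVec_eq_smul_of_mem_center hZ (v := (2 : ℂ) • f + basePt n) (by
      simp only [herm_add_left, herm_add_right, herm_smul_left, herm_smul_right, hff, hfb, hbf,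
        herm_basePt_self]
      norm_num)
    rw [mulVec_add, mulVec_smul, ha, hc] at hb'
    have h1 := congrFun hb' (Sum.inl i)
    have h2 := congrFun hb' (Sum.inr ())
    simp [hf, basePt] at h1 h2
    rw [ha, h2, ← mul_left_cancel₀ (two_ne_zero' ℂ) (h1.trans (mul_comm b 2))]
  · exact hc

/-! ### Uniqueness of the angles -/

/-- The arguments are reflected to `π - x` to move `[0, 2π)` into the half-open interval `(-π, π]`. -/
lemma exp_mul_I_injOn : Set.InjOn (fun x : ℝ => exp (x * I)) (Set.Ico 0 (2 * Real.pi)) := by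
  intro x hx y hy h
  have h' : exp (((Real.pi - x : ℝ) : ℂ) * I) = exp (((Real.pi - y : ℝ) : ℂ) * I) := by
    simp only at h
    push_cast
    rw [sub_mul, sub_mul, exp_sub, exp_sub, h]
  have := exp_inj_of_neg_pi_lt_of_le_pi (x := ((Real.pi - x : ℝ) : ℂ) * I)
    (y := ((Real.pi - y : ℝ) : ℂ) * I) (by rw [im_ofReal_mul, I_im]; linarith [hx.2])
    (by rw [im_ofReal_mul, I_im]; linarith [hx.1]) (by rw [im_ofReal_mul, I_im]; linarith [hy.2])
    (by rw [im_ofReal_mul, I_im]; linarith [hy.1]) h'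
  have h2 := ofReal_injective (mul_right_cancel₀ I_ne_zero this)
  linarith

lemma eq_of_antitone_of_map_eq {α β : Fin n → ℝ} (hα : Antitone α) (hβ : Antitone β)
    (h : Finset.univ.val.map α = Finset.univ.val.map β) : α = β := by
  rw [Fin.univ_val_map, Fin.univ_val_map, Multiset.coe_eq_coe] at h
  refine List.ofFn_injective (h.eq_of_pairwise' (r := (· ≥ ·)) ?_ ?_) <;>
  · rw [List.pairwise_ofFn]
    intro i j hij
    first | exact hα hij.le | exact hβ hij.le

lemma charpoly_E (α : Fin n → ℝ) : (E n α).1.1.charpoly =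
    (∏ i, (Polynomial.X - Polynomial.C (exp (α i * I)))) *
      (Polynomial.X - Polynomial.C 1) := by
  change (diagMatrix n α 0).charpoly = _
  rw [diagMatrix, charpoly_diagonal, Fintype.prod_sum_type]
  simp

lemma eq_of_isConj_E {α β : Fin n → ℝ} (hα : α ∈ angleSpace n) (hβ : β ∈ angleSpace n)
    (h : IsConj (E n α) (E n β)) : α = β := by
  obtain ⟨g, hg⟩ := isConj_iff.1 h
  have hc : (E n α).1.1.charpoly = (E n β).1.1.charpoly := by
    rw [← hg]
    have := Matrix.charpoly_units_conj g.1 (E n α).1.1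
    rw [← coe_units_inv] at this
    exact this.symm
  rw [charpoly_E, charpoly_E] at hc
  have hc' := congrArg Polynomial.roots (mul_right_cancel₀ (Polynomial.X_sub_C_ne_zero 1) hc)
  have roots (γ : Fin n → ℝ) : (∏ i, (Polynomial.X - Polynomial.C (exp (γ i * I)))).roots =
      Finset.univ.val.map fun i => exp (γ i * I) := by
    rw [← Polynomial.roots_multiset_prod_X_sub_C (Finset.univ.val.map fun i => exp (γ i * I)),
      Multiset.map_map]
    rfl
  rw [roots, roots] at hc'
  refine eq_of_antitone_of_map_eq hα.2 hβ.2 ?_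
  have inv := exp_mul_I_injOn.leftInvOn_invFunOn
  have hc'' := congrArg (Multiset.map (Function.invFunOn (fun x : ℝ => exp (x * I))
    (Set.Ico 0 (2 * Real.pi)))) hc'
  rw [Multiset.map_map, Multiset.map_map] at hc''
  convert hc'' using 2
  · exact (inv (hα.1 _)).symm
  · exact (inv (hβ.1 _)).symm

/-- Two lifts of `g` differ by a homothety. Its ratio is `1`, because `1` is the eigenvalue of both
`E n α` and `E n β` on negative eigenvectors; then the characteristic polynomials agree. -/
lemma HasAngles.unique {c : ConjClasses (PU n)} {α β : Fin n → ℝ} (hα : HasAngles n c α)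
    (hβ : HasAngles n c β) : α = β := by
  obtain ⟨g, rfl⟩ := ConjClasses.mk_surjective c
  obtain ⟨A, hA, hAα⟩ := hα.2 g rfl
  obtain ⟨B, hB, hBβ⟩ := hβ.2 g rfl
  have hZ : B⁻¹ * A ∈ Subgroup.center (U n) := QuotientGroup.eq.1 (hB.trans hA.symm)
  obtain ⟨ζ, hζ⟩ := eq_smul_of_mem_center hZ
  have hAB : ∀ x, A.1.1 *ᵥ x = ζ • (B.1.1 *ᵥ x) := fun x => by
    rw [← mulVec_smul, ← hζ, ← mul_mulVec, mul_inv_cancel_left]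
  obtain ⟨a, ha⟩ := isConj_iff.1 hAα
  obtain ⟨b, hb⟩ := isConj_iff.1 hBβ.symm
  -- The fixed negative vector of the conjugate of `E n β` is an eigenvector of that of `E n α`.
  set v := a.1.1 *ᵥ (b.1.1 *ᵥ basePt n) with hv
  have hEv : (E n α).1.1 *ᵥ v = ζ • v := by
    rw [← ha, hv, mul_mulVec, mul_mulVec, inv_mulVec_mulVec, hAB, ← hb, mul_mulVec, mul_mulVec,
      inv_mulVec_mulVec, E_mulVec_basePt, mulVec_smul]
  have hvv : herm n v v = -1 := by rw [hv, herm_mulVec, herm_mulVec, herm_basePt_self]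
  have hv0 : v (Sum.inr ()) ≠ 0 := fun h0 => by
    have h1 := posSq_eq hvv
    have h2 := posSq_nonneg v
    rw [h1, h0, norm_zero] at h2
    norm_num at h2
  have hζ1 : ζ = 1 := by
    have := congrFun hEv (Sum.inr ())
    rw [E_mulVec_inr, Pi.smul_apply, smul_eq_mul] at this
    exact mul_right_cancel₀ hv0 (by rw [one_mul, ← this])
  have hABeq : A = B := U_ext fun x => by rw [hAB, hζ1, one_smul]
  subst hABeq
  exact eq_of_isConj_E hα.1 hβ.1 (hAα.symm.trans hBβ)

/-! ### Standard lifts and representations -/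

/-- The homothety of ratio `e^{iφ}`, as an element of `U(n,1)`. -/
def homothety (n : ℕ) (φ : ℝ) : U n := diagU n (fun _ => φ) φ

lemma homothety_eq (φ : ℝ) : (homothety n φ).1.1 = exp (φ * I) • 1 := by
  change diagMatrix n _ _ = _
  rw [diagMatrix, ← diagonal_one, ← diagonal_smul]
  congr 1
  funext k
  rcases k with i | ⟨⟩ <;> simp

lemma homothety_mem_center (φ : ℝ) : homothety n φ ∈ Subgroup.center (U n) :=
  mem_center_of_eq_smul_one (homothety_eq φ)

/-- The standard lift differs from `E n α` by a homothety of determinant `det (E n α)⁻¹`. -/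
lemma standardU_eq (α : Fin n → ℝ) :
    standardU n α = homothety n (-(∑ k, α k) / (n + 1)) * E n α := by
  refine U_ext fun x => ?_
  rw [mul_mulVec, homothety_eq, smul_mulVec, one_mulVec]
  funext k
  rw [Pi.smul_apply, smul_eq_mul]
  rcases k with i | ⟨⟩
  · rw [standardU, diagU_mulVec_inl, E, diagU_mulVec_inl, ← mul_assoc, ← exp_add,
      Finset.sum_erase_eq_sub (Finset.mem_univ i)]
    have hn : (n : ℂ) + 1 ≠ 0 := by exact_mod_cast n.succ_ne_zero
    congr 2
    push_cast
    field_simp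
    ring
  · rw [standardU, diagU_mulVec_inr, E_mulVec_inr]

lemma conj_standardU (g : U n) (α : Fin n → ℝ) : g * standardU n α * g⁻¹ =
    homothety n (-(∑ k, α k) / (n + 1)) * (g * E n α * g⁻¹) := by
  rw [standardU_eq, ← mul_assoc g, Subgroup.mem_center_iff.1 (homothety_mem_center _) g]
  simp only [mul_assoc]

lemma proj_eq_one_of_mem_center {g : U n} (h : g ∈ Subgroup.center (U n)) : proj n g = 1 :=
  (QuotientGroup.eq_one_iff g).2 h

lemma proj_conj_standardU (g : U n) (α : Fin n → ℝ) :
    proj n (g * standardU n α * g⁻¹) = proj n (g * E n α * g⁻¹) := by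
  rw [conj_standardU, map_mul, proj_eq_one_of_mem_center (homothety_mem_center _), one_mul]

lemma hasAngles_mk_proj {α : Fin n → ℝ} (hα : α ∈ angleSpace n) (g : U n) :
    HasAngles n (ConjClasses.mk (proj n (g * standardU n α * g⁻¹))) α := by
  refine ⟨hα, fun g' hg' => ?_⟩
  obtain ⟨d, hd⟩ := isConj_iff.1 (ConjClasses.mk_eq_mk_iff_isConj.1 hg').symm
  obtain ⟨D, rfl⟩ := QuotientGroup.mk'_surjective _ d
  rw [proj_conj_standardU] at hd
  refine ⟨D * (g * E n α * g⁻¹) * D⁻¹, by rw [← hd, map_mul, map_mul, map_inv]; rfl, ?_⟩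
  exact (isConj_iff.2 ⟨D * g, by group⟩ : IsConj (E n α) _).symm

lemma isElliptic_proj (g : U n) (α : Fin n → ℝ) :
    IsElliptic n (proj n (g * standardU n α * g⁻¹)) := by
  have hb : basePt n ≠ 0 := fun h => by
    have := congrFun h (Sum.inr ()); simp [basePt] at this
  have hne : g.1.1 *ᵥ basePt n ≠ 0 := fun h => hb (by
    rw [← inv_mulVec_mulVec g (basePt n), h, mulVec_zero])
  refine ⟨Projectivization.mk ℂ _ hne, ⟨_, hne, ?_, rfl⟩, g * E n α * g⁻¹,
    (proj_conj_standardU g α).symm, ?_⟩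
  · rw [herm_mulVec, herm_basePt_self]; norm_num
  · rw [Projectivization.smul_mk, Projectivization.mk_eq_mk_iff']
    refine ⟨1, ?_⟩
    rw [one_smul]
    change _ = (g * E n α * g⁻¹).1.1 *ᵥ _
    rw [mul_mulVec, inv_mulVec_mulVec, mul_mulVec, E_mulVec_basePt]

/-- The angles in `solutionSet` are those for which three conjugates of the standard diagonal
matrices multiply to `u`. -/
lemma mem_solutionSet_iff {u : ℂ} {τ : Fin 3 → Fin n → ℝ} :
    τ ∈ solutionSet n u ↔ (∀ j, τ j ∈ angleSpace n) ∧ ∃ c : Fin 3 → SU n,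
      ((c 0).1 * standardU n (τ 0) * (c 0).1⁻¹ * ((c 1).1 * standardU n (τ 1) * (c 1).1⁻¹) *
        ((c 2).1 * standardU n (τ 2) * (c 2).1⁻¹)).1.1 = u • 1 := by
  constructor
  · rintro ⟨ρ, ⟨-, A, hA, hprod⟩, hτ⟩
    refine ⟨fun j => (hτ j).1, ?_⟩
    have : ∀ j, ∃ c : SU n, c.1 * standardU n (τ j) * c.1⁻¹ = (A j).1 := fun j => by
      obtain ⟨-, α, hα, hAα⟩ := hA j
      obtain rfl := hα.unique (hτ j)
      obtain ⟨c, hc⟩ := isConj_iff.1 (ConjClasses.mk_eq_mk_iff_isConj.1 hAα).symm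
      exact ⟨c, congrArg Subtype.val hc⟩
    choose c hc using this
    refine ⟨c, ?_⟩
    rw [hc, hc, hc]
    exact hprod
  · rintro ⟨hτ, c, hc⟩
    set A : Fin 3 → SU n := fun j =>
      c j * ⟨standardU n (τ j), standardU_mem n (τ j)⟩ * (c j)⁻¹ with hA
    have hAc : ∀ j, (A j).1 = (c j).1 * standardU n (τ j) * (c j).1⁻¹ := fun j => rfl
    rw [← hAc, ← hAc, ← hAc] at hc
    have hrel : ∀ r ∈ ({FreeGroup.of 0 * FreeGroup.of 1 * FreeGroup.of 2} :
        Set (FreeGroup (Fin 3))), FreeGroup.lift (fun j => proj n (A j).1) r = 1 := by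
      rintro r rfl
      simp only [map_mul, FreeGroup.lift_apply_of]
      rw [← map_mul, ← map_mul]
      exact proj_eq_one_of_mem_center (mem_center_of_eq_smul_one hc)
    have hρ : ∀ j, PresentedGroup.toGroup hrel (gen j) = proj n (A j).1 := fun j =>
      PresentedGroup.toGroup.of hrel
    have hang : ∀ j, HasAngles n (ConjClasses.mk (proj n (A j).1)) (τ j) := fun j => by
      rw [hAc]; exact hasAngles_mk_proj (hτ j) _
    refine ⟨PresentedGroup.toGroup hrel, ⟨fun j => ?_, A, fun j => ?_, hc⟩, fun j => ?_⟩
    · rw [hρ, hAc]; exact isElliptic_proj _ _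
    · rw [hρ]
      refine ⟨rfl, τ j, hang j, ?_⟩
      exact (ConjClasses.mk_eq_mk_iff_isConj.2 (isConj_iff.2 ⟨c j, rfl⟩)).symm
    · rw [hρ]; exact hang j

/-! ### Boundedness of normalized solutions -/

lemma exists_conj_E_mul_eq {u : ℂ} (hu : ‖u‖ = 1) (a b c : U n) {θ₀ θ₁ θ₂ : Fin n → ℝ}
    (h : (a * standardU n θ₀ * a⁻¹ * (b * standardU n θ₁ * b⁻¹) *
      (c * standardU n θ₂ * c⁻¹)).1.1 = u • 1) :
    ∃ κ : ℂ, ‖κ‖ = 1 ∧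
      (a * E n θ₀ * a⁻¹ * (b * E n θ₁ * b⁻¹) * (c * E n θ₂ * c⁻¹)).1.1 = κ • 1 := by
  have key : ∀ (g : U n) (θ : Fin n → ℝ), ∃ w : ℂ, ‖w‖ = 1 ∧
      (g * standardU n θ * g⁻¹).1.1 = w • (g * E n θ * g⁻¹).1.1 := fun g θ => by
    refine ⟨exp (((-(∑ k, θ k) / (n + 1) : ℝ) : ℂ) * I), norm_exp_ofReal_mul_I _, ?_⟩
    rw [conj_standardU]
    change (homothety n _).1.1 * (g * E n θ * g⁻¹).1.1 = _
    rw [homothety_eq, smul_mul_assoc, one_mul]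
  obtain ⟨w₀, h₀, e₀⟩ := key a θ₀
  obtain ⟨w₁, h₁, e₁⟩ := key b θ₁
  obtain ⟨w₂, h₂, e₂⟩ := key c θ₂
  have hw : w₀ * w₁ * w₂ ≠ 0 := by
    rw [← norm_ne_zero_iff, norm_mul, norm_mul, h₀, h₁, h₂]; norm_num
  refine ⟨(w₀ * w₁ * w₂)⁻¹ * u, by simp [h₀, h₁, h₂, hu], ?_⟩
  change (a * standardU n θ₀ * a⁻¹).1.1 * (b * standardU n θ₁ * b⁻¹).1.1 *
    (c * standardU n θ₂ * c⁻¹).1.1 = _ at h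
  rw [e₀, e₁, e₂, smul_mul_smul_comm, smul_mul_smul_comm] at h
  rw [mul_smul, ← h, inv_smul_smul₀ hw]
  rfl

/-- A scalar product of three elements is invariant under cyclic permutation, as it is central. -/
lemma mul_rotate_eq_smul_one {x y z : U n} {u : ℂ} (h : (x * y * z).1.1 = u • 1) :
    (z * x * y).1.1 = u • 1 := by
  have hc := Subgroup.mem_center_iff.1 (mem_center_of_eq_smul_one h) z
  rw [← h, show z * x * y = x * y * z from mul_right_cancel (b := z) (by rw [← hc]; group)]

lemma inv_eq_adjugate (g : SU n) : (g.1⁻¹).1.1 = adjugate g.1.1.1 := by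
  have hdet : g.1.1.1.det = 1 := congrArg Units.val (MonoidHom.mem_ker.1 g.2)
  have h1 : g.1.1.1 * (g.1⁻¹).1.1 = 1 := congrArg (fun k : U n => k.1.1) (mul_inv_cancel g.1)
  calc (g.1⁻¹).1.1 = (adjugate g.1.1.1 * g.1.1.1) * (g.1⁻¹).1.1 := by
        rw [adjugate_mul, hdet, one_smul, one_mul]
    _ = _ := by rw [mul_assoc, h1, mul_one]

/-- The underlying set of `SU(n,1)` in the space of matrices. -/
def matrixSU (n : ℕ) : Set (Matrix (Fin n ⊕ Unit) (Fin n ⊕ Unit) ℂ) :=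
  {m | m.det = 1 ∧ ∀ z w, herm n (m *ᵥ z) (m *ᵥ w) = herm n z w}

lemma isClosed_matrixSU : IsClosed (matrixSU n) := by
  refine IsClosed.inter (isClosed_eq (by fun_prop) continuous_const) ?_
  change IsClosed {m : Matrix (Fin n ⊕ Unit) (Fin n ⊕ Unit) ℂ |
    ∀ z w, herm n (m *ᵥ z) (m *ᵥ w) = herm n z w}
  simp only [Set.ofPred_forall]
  refine isClosed_iInter fun z => isClosed_iInter fun w => isClosed_eq ?_ continuous_const
  unfold herm mulVec dotProduct
  fun_prop

lemma exists_mem_SU {m : Matrix (Fin n ⊕ Unit) (Fin n ⊕ Unit) ℂ} (hm : m ∈ matrixSU n) :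
    ∃ g : SU n, g.1.1.1 = m :=
  ⟨⟨⟨⟨m, adjugate m, by rw [mul_adjugate, hm.1, one_smul], by rw [adjugate_mul, hm.1, one_smul]⟩,
    hm.2⟩, MonoidHom.mem_ker.2 (Units.ext hm.1)⟩, rfl⟩

lemma coe_mem_matrixSU (g : SU n) : g.1.1.1 ∈ matrixSU n :=
  ⟨congrArg Units.val (MonoidHom.mem_ker.1 g.2), g.1.2⟩

/-- The matrices whose entries have norm at most `R`. -/
def boundedMatrices (n : ℕ) (R : ℝ) : Set (Matrix (Fin n ⊕ Unit) (Fin n ⊕ Unit) ℂ) :=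
  Set.pi Set.univ fun _ => Set.pi Set.univ fun _ => Metric.closedBall 0 R

lemma isCompact_boundedMatrices (R : ℝ) : IsCompact (boundedMatrices n R) :=
  isCompact_univ_pi fun _ => isCompact_univ_pi fun _ => isCompact_closedBall 0 R

lemma mem_boundedMatrices {R : ℝ} {m : Matrix (Fin n ⊕ Unit) (Fin n ⊕ Unit) ℂ}
    (h : ∀ k l, ‖m k l‖ ≤ R) : m ∈ boundedMatrices n R :=
  fun k _ l _ => mem_closedBall_zero_iff.2 (h k l)

/-- The product `S₀ (h S₁ h⁻¹) (g S₂ g⁻¹)` of conjugates of the standard diagonal matrices with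
angles `τ`, for `h` and `g` in `SU(n,1)`. The adjugate stands for the inverse, so that the product
is a continuous function of all matrices `h` and `g`. -/
def conjProduct (τ : Fin 3 → Fin n → ℝ) (h g : Matrix (Fin n ⊕ Unit) (Fin n ⊕ Unit) ℂ) :
    Matrix (Fin n ⊕ Unit) (Fin n ⊕ Unit) ℂ :=
  (standardU n (τ 0)).1.1 * (h * (standardU n (τ 1)).1.1 * adjugate h) *
    (g * (standardU n (τ 2)).1.1 * adjugate g)

lemma continuous_standardU : Continuous fun α : Fin n → ℝ => (standardU n α).1.1 := by
  change Continuous fun α : Fin n → ℝ => diagMatrix n _ _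
  unfold diagMatrix
  refine Continuous.matrix_diagonal (continuous_pi fun k => ?_)
  rcases k with i | ⟨⟩ <;> simp only [Sum.elim_inl, Sum.elim_inr] <;> fun_prop

lemma conjProduct_coe (τ : Fin 3 → Fin n → ℝ) (h g : SU n) :
    conjProduct τ h.1.1.1 g.1.1.1 = (standardU n (τ 0) * (h.1 * standardU n (τ 1) * h.1⁻¹) *
      (g.1 * standardU n (τ 2) * g.1⁻¹)).1.1 := by
  rw [conjProduct, ← inv_eq_adjugate, ← inv_eq_adjugate]
  rfl

/-- The angles for which the equation `S₀ (h S₁ h⁻¹) (g S₂ g⁻¹) = u` has a solution with `h` and `g`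
in `SU(n,1)` bounded by `R`. -/
def boundedSolutionSet (n : ℕ) (u : ℂ) (R : ℝ) : Set (Fin 3 → Fin n → ℝ) :=
  {τ | ∃ h ∈ boundedMatrices n R, ∃ g ∈ boundedMatrices n R, h ∈ matrixSU n ∧ g ∈ matrixSU n ∧
    conjProduct τ h g = u • 1}

/-- The set is the projection of a closed set along a compact factor. -/
lemma isClosed_boundedSolutionSet (u : ℂ) (R : ℝ) : IsClosed (boundedSolutionSet n u R) := by
  have : CompactSpace (boundedMatrices n R) :=
    isCompact_iff_compactSpace.1 (isCompact_boundedMatrices R)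
  let Z : Set ((Fin 3 → Fin n → ℝ) × (boundedMatrices n R × boundedMatrices n R)) :=
    {x | x.2.1.1 ∈ matrixSU n ∧ x.2.2.1 ∈ matrixSU n ∧ conjProduct x.1 x.2.1.1 x.2.2.1 = u • 1}
  have hZ : IsClosed Z := by
    refine (isClosed_matrixSU.preimage (by fun_prop)).inter
      ((isClosed_matrixSU.preimage (by fun_prop)).inter (isClosed_eq ?_ continuous_const))
    unfold conjProduct
    have hS : ∀ j, Continuous fun x : (Fin 3 → Fin n → ℝ) ×
        (boundedMatrices n R × boundedMatrices n R) => (standardU n (x.1 j)).1.1 := fun j =>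
      continuous_standardU.comp (by fun_prop)
    have h1 : Continuous fun x : (Fin 3 → Fin n → ℝ) ×
        (boundedMatrices n R × boundedMatrices n R) => x.2.1.1 := by fun_prop
    have h2 : Continuous fun x : (Fin 3 → Fin n → ℝ) ×
        (boundedMatrices n R × boundedMatrices n R) => x.2.2.1 := by fun_prop
    exact ((hS 0).mul ((h1.mul (hS 1)).mul h1.matrix_adjugate)).mul
      ((h2.mul (hS 2)).mul h2.matrix_adjugate)
  have := isClosedMap_fst_of_compactSpace _ hZ
  convert this using 1
  ext τ
  constructor
  · rintro ⟨h, hh, g, hg, H⟩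
    exact ⟨(τ, ⟨h, hh⟩, ⟨g, hg⟩), H, rfl⟩
  · rintro ⟨⟨τ, h, g⟩, H, rfl⟩
    exact ⟨h.1, h.2, g.1, g.2, H⟩

lemma mem_solutionSet_of_mem_boundedSolutionSet {u : ℂ} {R : ℝ} {τ : Fin 3 → Fin n → ℝ}
    (hτ : ∀ j, τ j ∈ angleSpace n) (h : τ ∈ boundedSolutionSet n u R) : τ ∈ solutionSet n u := by
  obtain ⟨h, -, g, -, hh, hg, H⟩ := h
  obtain ⟨h, rfl⟩ := exists_mem_SU hh
  obtain ⟨g, rfl⟩ := exists_mem_SU hg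
  rw [conjProduct_coe] at H
  refine mem_solutionSet_iff.2 ⟨hτ, ![1, h, g], ?_⟩
  simpa using H

/-- Away from the walls where an angle vanishes, the solutions are uniformly bounded. -/
lemma mem_boundedSolutionSet {u : ℂ} (hu : ‖u‖ = 1) {ε : ℝ} (hε : ε ^ 2 ≤ 4) (h0 : 0 < ε)
    {τ : Fin 3 → Fin n → ℝ} (hτ : ∀ j i, ε ≤ ‖exp (τ j i * I) - 1‖) (h : τ ∈ solutionSet n u) :
    τ ∈ boundedSolutionSet n u (64 / ε ^ 4 + 1) := by
  obtain ⟨-, c, hc⟩ := mem_solutionSet_iff.1 h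
  have hR : 0 ≤ 64 / ε ^ 4 := by positivity
  have bound : ∀ j : Fin 3, ‖herm n ((c j).1.1.1 *ᵥ basePt n) ((c 0).1.1.1 *ᵥ basePt n)‖
      ≤ 64 / ε ^ 4 → ((c 0)⁻¹ * c j).1.1.1 ∈ boundedMatrices n (64 / ε ^ 4 + 1) := by
    intro j hj
    refine mem_boundedMatrices (norm_entry_le ((c 0)⁻¹ * c j).1 hR ?_)
    rw [show ((c 0)⁻¹ * c j).1 = (c 0).1⁻¹ * (c j).1 from rfl, mul_mulVec, herm_mulVec_left,
      inv_inv]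
    exact hj
  refine ⟨_, bound 1 ?_, _, bound 2 ?_, coe_mem_matrixSU _, coe_mem_matrixSU _, ?_⟩
  · obtain ⟨κ, hκ, H⟩ := exists_conj_E_mul_eq hu _ _ _ hc
    rw [norm_herm_comm]
    exact norm_herm_fixedPoints_le hε h0 (hτ 0) (hτ 1) _ _ _ hκ H
  · obtain ⟨κ, hκ, H⟩ := exists_conj_E_mul_eq hu _ _ _ (mul_rotate_eq_smul_one hc)
    exact norm_herm_fixedPoints_le hε h0 (hτ 2) (hτ 0) _ _ _ hκ H
  · -- Conjugation by `c 0` does not change a scalar matrix.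
    rw [conjProduct_coe, ← mul_rotate_eq_smul_one (x := (c 0).1 * standardU n (τ 0) * (c 0).1⁻¹ *
        ((c 1).1 * standardU n (τ 1) * (c 1).1⁻¹) * ((c 2).1 * standardU n (τ 2) * (c 2).1⁻¹))
      (y := (c 0).1) (z := (c 0).1⁻¹) (by rwa [mul_inv_cancel_right])]
    congr 2
    simp only [Subgroup.coe_mul, Subgroup.coe_inv]
    group

/-! ### The closed subset of the open chamber -/

lemma pos_of_mem_interior {α : Fin n → ℝ} (h : α ∈ interior (angleSpace n)) (i : Fin n) :
    0 < α i := by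
  have h1 : angleSpace n ⊆ (fun β : Fin n → ℝ => β i) ⁻¹' Set.Ici 0 := fun β hβ => (hβ.1 i).1
  have h2 := interior_mono h1 h
  rwa [← (isOpenMap_eval i).preimage_interior_eq_interior_preimage (continuous_apply i),
    interior_Ici] at h2

lemma exp_sub_one_ne_zero {α : Fin n → ℝ} (h : α ∈ interior (angleSpace n)) (i : Fin n) :
    exp (α i * I) - 1 ≠ 0 := fun h' => by
  have h1 := exp_mul_I_injOn (interior_subset h |>.1 i)
    (Set.left_mem_Ico.2 (by positivity : (0 : ℝ) < 2 * Real.pi))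
    (by simpa using sub_eq_zero.1 h')
  exact (pos_of_mem_interior h i).ne' h1

end ComplexHorn

end

theorem proposition3p12 (n : ℕ) (u : ℂ) (hu : u ^ (n + 1) = 1) :
    IsClosed {τ : ComplexHorn.interiorTriples n |
      (τ : Fin 3 → Fin n → ℝ) ∈ ComplexHorn.solutionSet n u} := by
  have hu' : ‖u‖ = 1 := Complex.norm_eq_one_of_pow_eq_one hu n.succ_ne_zero
  refine isClosed_of_closure_subset fun τ hτ => ?_
  -- All angles of `τ` stay at a positive distance `ε` from `0`, and so do those of its neighbors.
  obtain ⟨ε, h0, hε, hτε⟩ : ∃ ε : ℝ, 0 < ε ∧ ε ^ 2 ≤ 4 ∧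
      ∀ j i, ε < ‖Complex.exp (τ.1 j i * Complex.I) - 1‖ := by
    have hev : ∀ᶠ ε : ℝ in nhdsWithin 0 (Set.Ioi 0),
        ∀ j i, ε < ‖Complex.exp (τ.1 j i * Complex.I) - 1‖ := by
      simp only [Filter.eventually_all]
      exact fun j i => nhdsWithin_le_nhds (Iio_mem_nhds (norm_pos_iff.2
        (ComplexHorn.exp_sub_one_ne_zero (τ.2 j) i)))
    have hev2 : ∀ᶠ ε : ℝ in nhdsWithin 0 (Set.Ioi 0), ε < 1 :=
      nhdsWithin_le_nhds (Iio_mem_nhds one_pos)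
    obtain ⟨ε, h1, h2, h3⟩ := (hev.and (hev2.and self_mem_nhdsWithin)).exists
    have h3' : 0 < ε := h3
    exact ⟨ε, h3', by nlinarith, h1⟩
  have hV : IsOpen {σ : ComplexHorn.interiorTriples n |
      ∀ j i, ε < ‖Complex.exp (σ.1 j i * Complex.I) - 1‖} := by
    simp only [Set.ofPred_forall]
    refine isOpen_iInter_of_finite fun j => isOpen_iInter_of_finite fun i =>
      isOpen_lt continuous_const ?_
    have : Continuous fun σ : ComplexHorn.interiorTriples n => σ.1 j i :=
      (continuous_apply_apply j i).comp continuous_subtype_val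
    exact ((Complex.continuous_exp.comp
      ((Complex.continuous_ofReal.comp this).mul continuous_const)).sub continuous_const).norm
  have hcl := (ComplexHorn.isClosed_boundedSolutionSet (n := n) u (64 / ε ^ 4 + 1)).preimage
    (continuous_subtype_val (p := (· ∈ ComplexHorn.interiorTriples n)))
  have hmem := closure_minimal (fun (σ : ComplexHorn.interiorTriples n)
    (hσ : σ ∈ {σ : ComplexHorn.interiorTriples n | ∀ j i,
      ε < ‖Complex.exp (σ.1 j i * Complex.I) - 1‖} ∩ {σ : ComplexHorn.interiorTriples n |
        σ.1 ∈ ComplexHorn.solutionSet n u}) => ComplexHorn.mem_boundedSolutionSet hu' hε h0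
    (fun j i => (hσ.1 j i).le) hσ.2) hcl (hV.inter_closure ⟨hτε, hτ⟩)
  exact ComplexHorn.mem_solutionSet_of_mem_boundedSolutionSet
    (fun j => interior_subset (τ.2 j)) hmem
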